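/- **Lemma 4.1 (Smoothing property).** *Setting.* Let $d\in\{2,3\}$, let $\Omega\subset\mathbb R^d$ be a domain with $\operatorname{int}\overline\Omega=\Omega$, and let $\mathcal T_k$ be a finite partition of $\Omega$ into open elements $T=\mathsf F_T(\widehat T)$, where $\mathsf F_T$ is affine and invertible and $\widehat T$ is the open unit simplex or the open unit hypercube. Write $h_T=\operatorname{diam}T$, $h_k=\max_T h_T$, and let $p_k\ge 1$. Let $V_k$ be the space of functions $v$ with $v\circ\mathsf F_T\in\mathbb M^{p_k}(\widehat T)$ for all $T$, where $\mathbb M^{p_k}(\widehat T)$ is the space of polynomials of total degree $\le p_k$ (simplex) or of degree $\le p_k$ in each variable (hypercube). Let $\mathcal F_k=\mathcal F_k^I\cup\mathcal F_k^B$ be the set of interior and boundary faces, with $F=\partial T^+\cap\partial T^-$ for $F\in\mathcal F_k^I$ and outward unit normals $\mathbf n^\pm$ of $T^\pm$. On interior faces put $[\![v]\!]=v^+\mathbf n^++v^-\mathbf n^-$, $[\![\boldsymbol\eta]\!]=\boldsymbol\eta^+\cdot\mathbf n^++\boldsymbol\eta^-\cdot\mathbf n^-$, $\{\!\{\boldsymbol\eta\}\!\}=\frac12(\boldsymbol\eta^++\boldsymbol\eta^-)$;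 on boundary faces put $[\![v]\!]=v\,\mathbf n$, $\{\!\{\boldsymbol\eta\}\!\}=\boldsymbol\eta$. Define $r_F(\boldsymbol\tau)\in[V_k]^d$ ($F\in\mathcal F_k$) and $l_F(w)\in[V_k]^d$ ($F\in\mathcal F_k^I$) by $$\int_\Omega r_F(\boldsymbol\tau)\cdot\boldsymbol\eta\,dx=-\int_F\boldsymbol\tau\cdot\{\!\{\boldsymbol\eta\}\!\}\,ds,\qquad \int_\Omega l_F(w)\cdot\boldsymbol\eta\,dx=-\int_F w\,[\![\boldsymbol\eta]\!]\,ds\qquad\forall\boldsymbol\eta\in[V_k]^d,$$ and put $\mathcal G(v)=\sum_{F\in\mathcal F_k}r_F([\![v]\!])+\sum_{F\in\mathcal F_k^I}l_F(\boldsymbol\beta\cdot[\![v]\!])$. Let $$\mathcal A_k(w,v)=\sum_{T}\int_T\big(\nabla w\cdot\nabla v+\nabla w\cdot\mathcal G(v)+\mathcal G(w)\cdot\nabla v\big)dx+\sum_{F\in\mathcal F_k}\int_F\sigma_k[\![w]\!]\cdot[\![v]\!]\,ds+\theta\int_\Omega\mathcal G(w)\cdot\mathcal G(v)\,dx,$$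 with $\sigma_k|_F=\alpha_kp_k^2/\min(h_{T^+},h_{T^-})$ on interior faces, $\sigma_k|_F=\alpha_kp_k^2/h_T$ on boundary faces, $\alpha_k>0$, for one of the methods - SIPG: $\theta=0$, $\boldsymbol\beta=0$; - SIPG($\delta$): $\theta=0$, $\boldsymbol\beta|_F=(\delta_F-\frac12)\mathbf n^+$ with $\delta_F\in[0,1]$; - LDG: $\theta=1$, $\boldsymbol\beta\in\mathbb R^d$ constant. For SIPG and SIPG($\delta$) assume that $\alpha_k$ is large enough for coercivity, that is, $\mathcal A_k(v,v)>0$ for all $0\ne v\in V_k$. Let $(\phi_j)$ be the basis of $V_k$ obtained by mapping to each element a basis of $\mathbb M^{p_k}(\widehat T)$ that is orthonormal in $L^2(\widehat T)$, and for $u=\sum_ju_j\phi_j$, $v=\sum_jv_j\phi_j$ let $(u,v)_k=h_k^d\sum_ju_jv_j$. Let $A_k:V_k\to V_k$ be given by $(A_ku,v)_k=\mathcal A_k(u,v)$ for all $u,v\in V_k$, and let $|||v|||_{s,k}=\sqrt{(A_k^sv,v)_k}$, where $A_k^s$ is defined spectrally. Let $\Lambda_k\in\mathbb R$ be a bound for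 the spectral radius of $A_k$, and let $G_k=\mathrm I_k-\Lambda_k^{-1}A_k$ be the error propagation operator of the Richardson smoother. *Claim.* For every $C_\Lambda>0$ there is a constant $C>0$, depending only on $C_\Lambda$, such that in every setting as above with $\Lambda_k\le C_\Lambda\,p_k^4/h_k^2$, $$|||G_k^mv|||_{s,k}\le C\,p_k^{2(s-t)}\,h_k^{t-s}\,(1+m)^{(t-s)/2}\,|||v|||_{t,k}$$ for all $v\in V_k$, all integers $m\ge0$ and all real $0\le t\le s\le 2$. -/

import Mathlib

open MeasureTheory Module
open scoped Gradient RealInnerProductSpace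

noncomputable section

namespace HpDG

/-- The Euclidean space `ℝ^d`. -/
abbrev E (d : ℕ) := EuclideanSpace ℝ (Fin d)

/-! ### Reference elements -/

/-- The two kinds of reference elements: the unit simplex and the unit hypercube. -/
inductive RefShape where
  | simplex
  | cube

namespace RefShape

variable (d : ℕ)

/-- The open reference element in `ℝ^d`. -/
def cell : RefShape → Set (E d)
  | simplex => {x | (∀ i, 0 < x i) ∧ ∑ i, x i < 1}
  | cube => {x | ∀ i, 0 < x i ∧ x i < 1}

/-- The index set of the facets of the reference element. For the simplex, `some j` is the facet
`x_j = 0` and `none` is the facet `x_1 + ... + x_d = 1`. For the hypercube, `(j, false)` is the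
facet `x_j = 0` and `(j, true)` is the facet `x_j = 1`. -/
def Facet : RefShape → Type
  | simplex => Option (Fin d)
  | cube => Fin d × Bool

instance (S : RefShape) : Fintype (S.Facet d) :=
  match S with
  | simplex => inferInstanceAs (Fintype (Option (Fin d)))
  | cube => inferInstanceAs (Fintype (Fin d × Bool))

/-- An outward conormal vector of a facet of the reference element. -/
def conormal : (S : RefShape) → S.Facet d → E d
  | simplex, none => WithLp.toLp 2 (fun _ => 1)
  | simplex, some j => -EuclideanSpace.single j 1
  | cube, (j, true) => EuclideanSpace.single j 1
  | cube, (j, false) => -EuclideanSpace.single j 1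

/-- The facet with conormal `ν` lies in the hyperplane `⟪ν, x⟫ = offset`. -/
def offset : (S : RefShape) → S.Facet d → ℝ
  | simplex, none => 1
  | simplex, some _ => 0
  | cube, (_, true) => 1
  | cube, (_, false) => 0

/-- The closed facets of the reference element. -/
def facet (S : RefShape) (f : S.Facet d) : Set (E d) :=
  {x | x ∈ closure (S.cell d) ∧ ⟪S.conormal d f, x⟫ = S.offset d f}

/-- The polynomials on the reference element: total degree at most `p` on the simplex, degree at
most `p` in each variable on the hypercube. -/
def poly (p : ℕ) : RefShape → Submodule ℝ (MvPolynomial (Fin d) ℝ)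
  | simplex => MvPolynomial.restrictTotalDegree (Fin d) ℝ p
  | cube => MvPolynomial.restrictDegree (Fin d) ℝ p

instance (p : ℕ) (S : RefShape) : Module.Finite ℝ (S.poly d p) :=
  match S with
  | simplex => inferInstanceAs (Module.Finite ℝ (MvPolynomial.restrictTotalDegree (Fin d) ℝ p))
  | cube => inferInstanceAs (Module.Finite ℝ (MvPolynomial.restrictDegree (Fin d) ℝ p))

/-- The basis `b` of the reference polynomial space is orthonormal with respect to the
`L²`-inner product on the reference element. -/
def IsOrthonormalBasis {p n : ℕ} {S : RefShape} (b : Basis (Fin n) ℝ (S.poly d p)) : Prop :=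
  ∀ a c : Fin n,
    ∫ x in S.cell d, MvPolynomial.eval (fun j => x j) (b a : MvPolynomial (Fin d) ℝ) *
      MvPolynomial.eval (fun j => x j) (b c : MvPolynomial (Fin d) ℝ) = if a = c then 1 else 0

variable {d}

theorem isOpen_cell (S : RefShape) : IsOpen (S.cell d) := by
  have h0 : ∀ i, IsOpen {x : E d | 0 < x i} := fun i => isOpen_lt (by fun_prop) (by fun_prop)
  have h1 : ∀ i, IsOpen {x : E d | x i < 1} := fun i => isOpen_lt (by fun_prop) (by fun_prop)
  cases S with
  | simplex =>
    have h2 : IsOpen {x : E d | ∑ i, x i < 1} := isOpen_lt (by fun_prop) (by fun_prop)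
    convert (isOpen_iInter_of_finite h0).inter h2 using 1
    ext x
    simp [cell]
  | cube =>
    convert isOpen_iInter_of_finite fun i => (h0 i).inter (h1 i) using 1
    ext x
    simp [cell]

theorem cell_nonempty (S : RefShape) : (S.cell d).Nonempty := by
  cases S with
  | simplex =>
    refine ⟨WithLp.toLp 2 (fun _ => 1 / ((d : ℝ) + 1)), fun i => ?_, ?_⟩
    · show 0 < 1 / ((d : ℝ) + 1)
      positivity
    · simp only [Finset.sum_const, Finset.card_univ, Fintype.card_fin, nsmul_eq_mul]
      rw [mul_one_div, div_lt_one (by positivity)]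
      linarith
  | cube =>
    refine ⟨WithLp.toLp 2 (fun _ => 1 / 2), fun i => ?_⟩
    show (0 : ℝ) < 1 / 2 ∧ (1 / 2 : ℝ) < 1
    norm_num

theorem isBounded_cell (S : RefShape) : Bornology.IsBounded (S.cell d) := by
  have key : ∀ x ∈ S.cell d, ∀ i, 0 < x i ∧ x i < 1 := by
    cases S with
    | simplex =>
      intro x hx i
      refine ⟨hx.1 i, lt_of_le_of_lt ?_ hx.2⟩
      exact Finset.single_le_sum (f := fun i => x i) (fun j _ => (hx.1 j).le) (Finset.mem_univ i)
    | cube => exact fun x hx => hx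
  refine (Metric.isBounded_iff_subset_closedBall 0).2 ⟨√(d : ℝ), fun x hx => ?_⟩
  rw [mem_closedBall_zero_iff, EuclideanSpace.norm_eq]
  refine Real.sqrt_le_sqrt ?_
  calc ∑ i, ‖x i‖ ^ 2 ≤ ∑ _i : Fin d, (1 : ℝ) := by
        refine Finset.sum_le_sum fun i _ => ?_
        have := key x hx i
        rw [Real.norm_eq_abs, sq_abs]
        nlinarith
    _ = d := by simp

theorem isCompact_closure_cell (S : RefShape) : IsCompact (closure (S.cell d)) :=
  S.isBounded_cell.isCompact_closure

theorem isCompact_facet (S : RefShape) (f : S.Facet d) : IsCompact (S.facet d f) :=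
  S.isCompact_closure_cell.inter_right (isClosed_eq (by fun_prop) continuous_const)

theorem conormal_ne_zero {S : RefShape} {f : S.Facet d} (h : (S.facet d f).Nonempty) :
    S.conormal d f ≠ 0 := by
  match S, f, h with
  | simplex, none, ⟨x, hx⟩ =>
    intro h0
    have := hx.2
    rw [h0, inner_zero_left] at this
    exact zero_ne_one this
  | simplex, some j, _ => simp [conormal]
  | cube, (j, true), _ => simp [conormal]
  | cube, (j, false), _ => simp [conormal]

end RefShape

/-! ### Meshes -/

/-- A partition of a domain `Ω ⊆ ℝ^d` into finitely many open elements, each the image of the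
reference element under an invertible affine map. The elements are pairwise disjoint and their
closures cover the closure of `Ω`; `Ω` lies locally on one side of its boundary in the sense that
it is the interior of its closure. -/
structure Mesh (d : ℕ) where
  /-- the domain `Ω` -/
  domain : Set (E d)
  isOpen_domain : IsOpen domain
  isConnected_domain : IsConnected domain
  interior_closure_domain : interior (closure domain) = domain
  /-- the reference element -/
  shape : RefShape
  /-- the number of elements -/
  card : ℕ
  /-- the affine map onto the `i`-th element -/
  map : Fin card → (E d ≃ᴬ[ℝ] E d)
  disjoint : ∀ i j, i ≠ j → Disjoint (map i '' shape.cell d) (map j '' shape.cell d)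
  cover : ⋃ i, closure (map i '' shape.cell d) = closure domain

namespace Mesh

variable {d : ℕ} (𝓜 : Mesh d)

/-- The `i`-th element `T`. -/
def elt (i : Fin 𝓜.card) : Set (E d) := 𝓜.map i '' 𝓜.shape.cell d

/-- The diameter `h_T` of the `i`-th element. -/
def eltSize (i : Fin 𝓜.card) : ℝ := Metric.diam (𝓜.elt i)

/-- The mesh size `h = max_T h_T`. -/
def size : ℝ := ⨆ i, 𝓜.eltSize i

/-- The closed facets of the `i`-th element. -/
def facet (i : Fin 𝓜.card) (f : 𝓜.shape.Facet d) : Set (E d) := 𝓜.map i '' 𝓜.shape.facet d f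

/-- The outward unit normal of the `i`-th element on its facet `f`: if `B` is the linear part of
the inverse of the affine map, then `Bᵀ ν` is an outward conormal. -/
def normal (i : Fin 𝓜.card) (f : 𝓜.shape.Facet d) : E d :=
  let B : E d →ₗ[ℝ] E d := (𝓜.map i).symm.toAffineEquiv.linear
  let w : E d := LinearMap.adjoint B (𝓜.shape.conormal d f)
  ‖w‖⁻¹ • w

/-- Interior faces: pairs of facets of two different elements, the element with the
smaller index being `T⁺`. The face is the intersection of the two facets. (Pairs that meet in a
set of vanishing surface measure are included in the index set; everything is defined by
integrals over the face, so that these contribute nothing.) -/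
def IntFace : Type :=
  {q : (Fin 𝓜.card × 𝓜.shape.Facet d) × (Fin 𝓜.card × 𝓜.shape.Facet d) // q.1.1 < q.2.1}

instance : Fintype 𝓜.IntFace := by
  classical
  exact inferInstanceAs (Fintype
    {q : (Fin 𝓜.card × 𝓜.shape.Facet d) × (Fin 𝓜.card × 𝓜.shape.Facet d) // q.1.1 < q.2.1})

/-- Boundary faces: for each facet of an element, its part on the boundary of `Ω`. -/
def BdryFace : Type := Fin 𝓜.card × 𝓜.shape.Facet d

instance : Fintype 𝓜.BdryFace := inferInstanceAs (Fintype (Fin 𝓜.card × 𝓜.shape.Facet d))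

/-- All faces. -/
abbrev Face : Type := 𝓜.IntFace ⊕ 𝓜.BdryFace

/-- The point set of a face. -/
def facePts : 𝓜.Face → Set (E d)
  | .inl F => 𝓜.facet F.1.1.1 F.1.1.2 ∩ 𝓜.facet F.1.2.1 F.1.2.2
  | .inr F => 𝓜.facet F.1 F.2 ∩ frontier 𝓜.domain

/-- The surface measure on a face. -/
def faceMeasure (F : 𝓜.Face) : Measure (E d) := μHE[d - 1].restrict (𝓜.facePts F)

/-- The volume measure on an element. -/
def eltMeasure (i : Fin 𝓜.card) : Measure (E d) := volume.restrict (𝓜.elt i)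

/-- The penalty function: `α p² / min(h_{T⁺}, h_{T⁻})` on interior faces and `α p² / h_T` on
boundary faces. -/
def penalty (p : ℕ) (α : ℝ) : 𝓜.Face → ℝ
  | .inl F => α * (p : ℝ) ^ 2 / min (𝓜.eltSize F.1.1.1) (𝓜.eltSize F.1.2.1)
  | .inr F => α * (p : ℝ) ^ 2 / 𝓜.eltSize F.1

variable {𝓜}

theorem isOpen_elt (i : Fin 𝓜.card) : IsOpen (𝓜.elt i) :=
  (𝓜.map i).toHomeomorph.isOpenMap _ 𝓜.shape.isOpen_cell

theorem elt_nonempty (i : Fin 𝓜.card) : (𝓜.elt i).Nonempty := 𝓜.shape.cell_nonempty.image _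

theorem isBounded_elt (i : Fin 𝓜.card) : Bornology.IsBounded (𝓜.elt i) :=
  ((𝓜.shape.isCompact_closure_cell.image (𝓜.map i).continuous).isBounded).subset
    (Set.image_mono subset_closure)

theorem isCompact_facet (i : Fin 𝓜.card) (f : 𝓜.shape.Facet d) : IsCompact (𝓜.facet i f) :=
  (𝓜.shape.isCompact_facet f).image (𝓜.map i).continuous

theorem measure_facet_lt_top (i : Fin 𝓜.card) (f : 𝓜.shape.Facet d) :
    (μHE[d - 1] : Measure (E d)) (𝓜.facet i f) < ⊤ := by
  rcases (𝓜.shape.facet d f).eq_empty_or_nonempty with h0 | h0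
  · simp [facet, h0]
  have hν := RefShape.conormal_ne_zero h0
  obtain ⟨x₀, hx₀⟩ := h0
  set ν := 𝓜.shape.conormal d f
  set W : Submodule ℝ (E d) := (ℝ ∙ ν)ᗮ
  obtain ⟨n, rfl⟩ : ∃ n, d = n + 1 := by
    rcases d with _ | n
    · exact absurd (Subsingleton.elim ν 0) hν
    · exact ⟨n, rfl⟩
  have : Fact (finrank ℝ (E (n + 1)) = n + 1) := ⟨by simp⟩
  have hW : finrank ℝ W = n := Submodule.finrank_orthogonal_span_singleton hν
  let g : W → E (n + 1) := fun w => 𝓜.map i (x₀ + (w : E (n + 1)))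
  let L : E (n + 1) →L[ℝ] E (n + 1) := LinearMap.toContinuousLinearMap
    ((𝓜.map i).toAffineEquiv.linear : E (n + 1) →ₗ[ℝ] E (n + 1))
  have hg : LipschitzWith ‖L‖₊ g := by
    refine LipschitzWith.of_dist_le_mul fun w w' => ?_
    have h1 : g w - g w' = L ((w : E (n + 1)) - w') := by
      have := ((𝓜.map i).toAffineEquiv).toAffineMap.linearMap_vsub
        (x₀ + (w : E (n + 1))) (x₀ + (w' : E (n + 1)))
      simp only [vsub_eq_sub, add_sub_add_left_eq_sub] at this
      exact this.symm
    rw [dist_eq_norm, h1]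
    exact L.le_opNorm _
  set K : Set W := {w | x₀ + (w : E (n + 1)) ∈ 𝓜.shape.facet (n + 1) f}
  have hK : IsCompact K := by
    have he : Topology.IsClosedEmbedding (fun w : W => x₀ + (w : E (n + 1))) :=
      (Homeomorph.addLeft x₀).isClosedEmbedding.comp
        (Submodule.closed_of_finiteDimensional W).isClosedEmbedding_subtypeVal
    exact he.isCompact_preimage (𝓜.shape.isCompact_facet f)
  have hsub : 𝓜.facet i f ⊆ g '' K := by
    rintro _ ⟨x, hx, rfl⟩
    have hxW : x - x₀ ∈ W := by
      rw [Submodule.mem_orthogonal_singleton_iff_inner_right, inner_sub_right, hx.2, hx₀.2,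
        sub_self]
    refine ⟨⟨x - x₀, hxW⟩, ?_, ?_⟩
    · simpa [K] using hx
    · simp [g]
  have hfin : (Measure.hausdorffMeasure (n : ℝ) : Measure (E (n + 1))) (g '' K) < ⊤ := by
    refine lt_of_le_of_lt (hg.hausdorffMeasure_image_le (by positivity) K) ?_
    refine ENNReal.mul_lt_top (by simp) ?_
    have := (MeasureTheory.isAddHaarMeasure_hausdorffMeasure (E := W))
    rw [hW] at this
    exact hK.measure_lt_top
  rw [Nat.add_sub_cancel, Measure.euclideanHausdorffMeasure_def, Measure.smul_apply]
  exact ENNReal.mul_lt_top (by simp) (lt_of_le_of_lt (measure_mono hsub) hfin)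

theorem isCompact_facePts (F : 𝓜.Face) : IsCompact (𝓜.facePts F) := by
  rcases F with F | F
  · exact (isCompact_facet _ _).inter (isCompact_facet _ _)
  · exact (isCompact_facet _ _).inter_right isClosed_frontier

theorem measure_facePts_lt_top (F : 𝓜.Face) :
    (μHE[d - 1] : Measure (E d)) (𝓜.facePts F) < ⊤ := by
  rcases F with F | F
  · exact lt_of_le_of_lt (measure_mono Set.inter_subset_left) (measure_facet_lt_top _ _)
  · exact lt_of_le_of_lt (measure_mono Set.inter_subset_left) (measure_facet_lt_top _ _)

theorem integrable_faceMeasure (F : 𝓜.Face) (f : C(E d, ℝ)) :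
    Integrable f (𝓜.faceMeasure F) :=
  f.continuous.continuousOn.integrableOn_of_subset_isCompact (isCompact_facePts F)
    (isCompact_facePts F).measurableSet subset_rfl (measure_facePts_lt_top F).ne

theorem integrable_eltMeasure (i : Fin 𝓜.card) (f : C(E d, ℝ)) :
    Integrable f (𝓜.eltMeasure i) :=
  (f.continuous.continuousOn.integrableOn_compact
    (isBounded_elt i).isCompact_closure).mono_set subset_closure

theorem card_pos (𝓜 : Mesh d) : 0 < 𝓜.card := by
  by_contra h
  have h0 : 𝓜.card = 0 := by omega
  have : IsEmpty (Fin 𝓜.card) := by rw [h0]; infer_instance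
  have h1 := 𝓜.cover
  rw [Set.iUnion_of_empty] at h1
  obtain ⟨x, hx⟩ := 𝓜.isConnected_domain.nonempty
  have := subset_closure hx
  rw [← h1] at this
  exact this

theorem size_pos (𝓜 : Mesh d) (hd : 0 < d) : 0 < 𝓜.size := by
  have i : Fin 𝓜.card := ⟨0, 𝓜.card_pos⟩
  have : Nonempty (Fin d) := ⟨⟨0, hd⟩⟩
  refine lt_of_lt_of_le ?_ (le_ciSup (Set.finite_range _).bddAbove i)
  refine Metric.diam_pos ?_ (isBounded_elt i)
  obtain ⟨x, hx⟩ := elt_nonempty (𝓜 := 𝓜) i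
  exact infinite_of_mem_nhds x ((isOpen_elt i).mem_nhds hx) |>.nontrivial

end Mesh

/-! ### Broken polynomial functions -/

variable {d : ℕ} (𝓜 : Mesh d) (p : ℕ)

/-- The discontinuous finite element space `V`. A function `v` with `v ∘ F_T` a polynomial on the
reference element for each element `T` is represented by these polynomials, one for each `T`. -/
abbrev V : Type := Fin 𝓜.card → 𝓜.shape.poly d p

/-- The space `[V]^d`. -/
abbrev VecV : Type := Fin d → V 𝓜 p

variable {𝓜 p}

theorem contDiff_loc (i : Fin 𝓜.card) (q : MvPolynomial (Fin d) ℝ) :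
    ContDiff ℝ 1 (fun x : E d => MvPolynomial.eval (fun j => (𝓜.map i).symm x j) q) := by
  have hc : ∀ j, ContDiff ℝ 1 (fun x : E d => (𝓜.map i).symm x j) := fun j =>
    (EuclideanSpace.proj j : E d →L[ℝ] ℝ).contDiff.comp
      ((𝓜.map i).symm.toContinuousAffineMap).contDiff
  induction q using MvPolynomial.induction_on with
  | C a => simpa using contDiff_const
  | add p q hp hq => simpa using hp.add hq
  | mul_X p j hp => simpa using hp.mul (hc j)

/-- The restriction of `v` to the element `T = F_T(T̂)`: the function `v̂ ∘ F_T⁻¹`, extended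
polynomially to the whole space, so that its values on `∂T` are the traces from within `T`. -/
def loc (i : Fin 𝓜.card) : V 𝓜 p →ₗ[ℝ] C(E d, ℝ) where
  toFun v := ⟨fun x => MvPolynomial.eval (fun j => (𝓜.map i).symm x j)
    (v i : MvPolynomial (Fin d) ℝ), (contDiff_loc i _).continuous⟩
  map_add' v w := by ext x; simp
  map_smul' c v := by ext x; simp

theorem contDiff_loc' (i : Fin 𝓜.card) (v : V 𝓜 p) : ContDiff ℝ 1 (loc i v) := contDiff_loc i _

/-- The gradient of `v` on an element. -/
def grad (i : Fin 𝓜.card) : V 𝓜 p →ₗ[ℝ] C(E d, E d) where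
  toFun v := ⟨fun x => ∇ (loc i v) x,
    (InnerProductSpace.toDual ℝ (E d)).symm.continuous.comp
      ((contDiff_loc' i v).continuous_fderiv (by norm_num))⟩
  map_add' v w := by
    ext1 x
    have hv := ((contDiff_loc' i v).differentiable (by norm_num)) x
    have hw := ((contDiff_loc' i w).differentiable (by norm_num)) x
    have : (⇑(loc i (v + w)) : E d → ℝ) = ⇑(loc i v) + ⇑(loc i w) := by
      rw [map_add]; rfl
    simp only [ContinuousMap.coe_mk, ContinuousMap.add_apply, gradient]
    rw [this, fderiv_add hv hw, map_add]
  map_smul' c v := by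
    ext1 x
    have hv := ((contDiff_loc' i v).differentiable (by norm_num)) x
    have : (⇑(loc i (c • v)) : E d → ℝ) = c • ⇑(loc i v) := by
      rw [map_smul]; rfl
    simp only [ContinuousMap.coe_mk, ContinuousMap.smul_apply, gradient, RingHom.id_apply]
    rw [this, fderiv_const_smul hv, map_smulₛₗ]
    simp

/-- The restriction of a vector-valued function `η ∈ [V]^d` to an element. -/
def vloc (i : Fin 𝓜.card) : VecV 𝓜 p →ₗ[ℝ] C(E d, E d) where
  toFun η := ⟨fun x => WithLp.toLp 2 (fun c => loc i (η c) x), by fun_prop⟩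
  map_add' v w := by ext x; simp
  map_smul' c v := by ext x; simp

/-- Multiplication of a scalar function by a constant vector. -/
def mulVec (n : E d) : C(E d, ℝ) →ₗ[ℝ] C(E d, E d) where
  toFun f := ⟨fun x => f x • n, by fun_prop⟩
  map_add' f g := by ext x; simp [add_mul]
  map_smul' c f := by ext x; simp [mul_assoc]

/-- Scalar product of a vector-valued function with a constant vector. -/
def dotVec (n : E d) : C(E d, E d) →ₗ[ℝ] C(E d, ℝ) where
  toFun f := ⟨fun x => ⟪f x, n⟫, by fun_prop⟩
  map_add' f g := by ext x; simp [inner_add_left]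
  map_smul' c f := by ext x; simp [inner_smul_left]

/-- The jump `⟦v⟧ = v⁺ n⁺ + v⁻ n⁻` (on boundary faces `v n`) of a scalar function. -/
def jump : 𝓜.Face → (V 𝓜 p →ₗ[ℝ] C(E d, E d))
  | .inl F => mulVec (𝓜.normal F.1.1.1 F.1.1.2) ∘ₗ loc F.1.1.1 +
      mulVec (𝓜.normal F.1.2.1 F.1.2.2) ∘ₗ loc F.1.2.1
  | .inr F => mulVec (𝓜.normal F.1 F.2) ∘ₗ loc F.1

/-- The average `{η} = (η⁺ + η⁻) / 2` (on boundary faces `η`) of a vector-valued function. -/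
def avg : 𝓜.Face → (VecV 𝓜 p →ₗ[ℝ] C(E d, E d))
  | .inl F => (1 / 2 : ℝ) • (vloc F.1.1.1 + vloc F.1.2.1)
  | .inr F => vloc F.1

/-- The jump `⟦η⟧ = η⁺ · n⁺ + η⁻ · n⁻` of a vector-valued function on an interior face. -/
def vecJump (F : 𝓜.IntFace) : VecV 𝓜 p →ₗ[ℝ] C(E d, ℝ) :=
  dotVec (𝓜.normal F.1.1.1 F.1.1.2) ∘ₗ vloc F.1.1.1 +
    dotVec (𝓜.normal F.1.2.1 F.1.2.2) ∘ₗ vloc F.1.2.1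

/-! ### Bilinear forms -/

/-- The pairing `∫ f · g dμ` of continuous functions. -/
def pairing {G : Type*} [NormedAddCommGroup G] [InnerProductSpace ℝ G] (μ : Measure (E d))
    (hμ : ∀ f : C(E d, ℝ), Integrable f μ) : C(E d, G) →ₗ[ℝ] C(E d, G) →ₗ[ℝ] ℝ :=
  have hint : ∀ f g : C(E d, G), Integrable (fun x => ⟪f x, g x⟫) μ :=
    fun f g => hμ ⟨fun x => ⟪f x, g x⟫, by fun_prop⟩
  LinearMap.mk₂ ℝ (fun f g => ∫ x, ⟪f x, g x⟫ ∂μ)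
    (fun f f' g => by
      simp only [ContinuousMap.add_apply, inner_add_left]
      exact integral_add (hint f g) (hint f' g))
    (fun c f g => by
      simp only [ContinuousMap.smul_apply, inner_smul_left, conj_trivial, smul_eq_mul]
      exact integral_const_mul _ _)
    (fun f g g' => by
      simp only [ContinuousMap.add_apply, inner_add_right]
      exact integral_add (hint f g) (hint f g'))
    (fun c f g => by
      simp only [ContinuousMap.smul_apply, inner_smul_right, smul_eq_mul]
      exact integral_const_mul _ _)

/-- `∫_T f · g dx`. -/
def eltPairing (i : Fin 𝓜.card) : C(E d, E d) →ₗ[ℝ] C(E d, E d) →ₗ[ℝ] ℝ :=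
  pairing (𝓜.eltMeasure i) (Mesh.integrable_eltMeasure i)

/-- `∫_F f · g ds`. -/
def facePairing {G : Type*} [NormedAddCommGroup G] [InnerProductSpace ℝ G] (F : 𝓜.Face) :
    C(E d, G) →ₗ[ℝ] C(E d, G) →ₗ[ℝ] ℝ :=
  pairing (𝓜.faceMeasure F) (Mesh.integrable_faceMeasure F)

/-- The `L²(Ω)^d`-inner product on `[V]^d`. -/
def vecL2 : LinearMap.BilinForm ℝ (VecV 𝓜 p) :=
  ∑ i, (eltPairing i).compl₁₂ (vloc i) (vloc i)

theorem eq_zero_of_loc_eq_zero (i : Fin 𝓜.card) (v : V 𝓜 p)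
    (h : ∀ x ∈ 𝓜.elt i, loc i v x = 0) : v i = 0 := by
  obtain ⟨x₀, hx₀⟩ := 𝓜.shape.cell_nonempty (d := d)
  have hnhds : 𝓜.shape.cell d ∈ nhds x₀ := 𝓜.shape.isOpen_cell.mem_nhds hx₀
  have hU : (WithLp.toLp 2) ⁻¹' (𝓜.shape.cell d) ∈ nhds (WithLp.ofLp x₀) :=
    (PiLp.continuous_toLp 2 (fun _ : Fin d => ℝ)).continuousAt.preimage_mem_nhds (by simpa)
  rw [nhds_pi, Filter.mem_pi'] at hU
  obtain ⟨I, t, ht, hsub⟩ := hU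
  apply Subtype.ext
  refine MvPolynomial.funext_set t (fun j => infinite_of_mem_nhds _ (ht j)) fun y hy => ?_
  have hy' : WithLp.toLp 2 y ∈ 𝓜.shape.cell d :=
    hsub (Set.pi_mono' (fun j _ => subset_rfl) (Set.subset_univ _) hy)
  have := h (𝓜.map i (WithLp.toLp 2 y)) ⟨_, hy', rfl⟩
  simpa [loc] using this

theorem vecL2_self_eq_zero (η : VecV 𝓜 p) (h : vecL2 η η = 0) : η = 0 := by
  have hs : vecL2 η η = ∑ i, ∫ x in 𝓜.elt i, ⟪vloc i η x, vloc i η x⟫ := by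
    simp only [vecL2, LinearMap.sum_apply]
    rfl
  rw [hs, Finset.sum_eq_zero_iff_of_nonneg
    (fun i _ => integral_nonneg fun x => real_inner_self_nonneg)] at h
  funext c i
  refine eq_zero_of_loc_eq_zero i (η c) ?_
  have hi := h i (Finset.mem_univ i)
  rw [integral_eq_zero_iff_of_nonneg (fun x => real_inner_self_nonneg)
    (Mesh.integrable_eltMeasure i ⟨fun x => ⟪vloc i η x, vloc i η x⟫, by fun_prop⟩)] at hi
  have h2 := Measure.eqOn_open_of_ae_eq hi (Mesh.isOpen_elt i)
    (by fun_prop) (by fun_prop)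
  intro x hx
  have h3 : ⟪vloc i η x, vloc i η x⟫ = 0 := h2 hx
  rw [inner_self_eq_zero] at h3
  exact congrArg (fun z : E d => z c) h3

theorem vecL2_nondegenerate : (vecL2 (𝓜 := 𝓜) (p := p)).Nondegenerate :=
  ⟨fun η h => vecL2_self_eq_zero η (h η), fun η h => vecL2_self_eq_zero η (h η)⟩

/-- The element of `[V]^d` that represents a linear functional on `[V]^d` in `L²(Ω)^d`. -/
def riesz : Module.Dual ℝ (VecV 𝓜 p) →ₗ[ℝ] VecV 𝓜 p :=
  (vecL2.toDual vecL2_nondegenerate).symm.toLinearMap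

/-- `v ↦ r_F(⟦v⟧)`, where `∫_Ω r_F(τ) · η dx = -∫_F τ · {η} ds` for all `η ∈ [V]^d`. -/
def rLift (F : 𝓜.Face) : V 𝓜 p →ₗ[ℝ] VecV 𝓜 p :=
  riesz ∘ₗ (-(facePairing F).compl₁₂ (jump F) (avg F))

/-- `v ↦ l_F(β · ⟦v⟧)`, where `∫_Ω l_F(w) · η dx = -∫_F w ⟦η⟧ ds` for all `η ∈ [V]^d`. -/
def lLift (F : 𝓜.IntFace) (β : E d) : V 𝓜 p →ₗ[ℝ] VecV 𝓜 p :=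
  riesz ∘ₗ (-(facePairing (.inl F)).compl₁₂ (dotVec β ∘ₗ jump (.inl F)) (vecJump F))

theorem rLift_spec (F : 𝓜.Face) (v : V 𝓜 p) (η : VecV 𝓜 p) :
    vecL2 (rLift F v) η = -∫ x, ⟪jump F v x, avg F η x⟫ ∂𝓜.faceMeasure F := by
  have : vecL2 (rLift F v) η = (-(facePairing F).compl₁₂ (jump F) (avg F)) v η :=
    LinearMap.BilinForm.apply_toDual_symm_apply (hB := vecL2_nondegenerate) _ _
  rw [this]
  rfl

theorem lLift_spec (F : 𝓜.IntFace) (β : E d) (v : V 𝓜 p) (η : VecV 𝓜 p) :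
    vecL2 (lLift F β v) η =
      -∫ x, ⟪jump (.inl F) v x, β⟫ * vecJump F η x ∂𝓜.faceMeasure (.inl F) := by
  have : vecL2 (lLift F β v) η = (-(facePairing (.inl F)).compl₁₂
      (dotVec β ∘ₗ jump (.inl F)) (vecJump F)) v η :=
    LinearMap.BilinForm.apply_toDual_symm_apply (hB := vecL2_nondegenerate) _ _
  rw [this]
  simp only [LinearMap.neg_apply, neg_inj]
  refine integral_congr_ae (Filter.Eventually.of_forall fun x => ?_)
  exact mul_comm _ _

variable (𝓜) in
/-- The DG methods. SIPG(δ) uses a weight `δ_F ∈ [0,1]` on `T⁺` and `1 - δ_F` on `T⁻`, for each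
interior face (replacing `δ_F` by `1 - δ_F` exchanges the roles of `T⁺` and `T⁻`). -/
inductive Method where
  | sipg
  | sipgDelta (δ : 𝓜.IntFace → Set.Icc (0 : ℝ) 1)
  | ldg (β : E d)

namespace Method

/-- `θ = 0` for SIPG and SIPG(δ), `θ = 1` for LDG. -/
def theta : Method 𝓜 → ℝ
  | sipg => 0
  | sipgDelta _ => 0
  | ldg _ => 1

/-- The vector `β` on an interior face: `0` for SIPG, `(δ - 1/2) n` for SIPG(δ), constant for
LDG. -/
def beta : Method 𝓜 → 𝓜.IntFace → E d
  | sipg, _ => 0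
  | sipgDelta δ, F => ((δ F : ℝ) - 1 / 2) • 𝓜.normal F.1.1.1 F.1.1.2
  | ldg β, _ => β

end Method

/-- `v ↦ R(⟦v⟧) + L(β · ⟦v⟧)`, with `R` and `L` the sums of the local liftings. -/
def lift (M : Method 𝓜) : V 𝓜 p →ₗ[ℝ] VecV 𝓜 p :=
  ∑ F : 𝓜.Face, rLift F + ∑ F : 𝓜.IntFace, lLift F (M.beta F)

/-- `(w, v) ↦ ∑_T ∫_T ∇w · ∇v dx`. -/
def gradGrad : LinearMap.BilinForm ℝ (V 𝓜 p) :=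
  ∑ i, (eltPairing i).compl₁₂ (grad i) (grad i)

/-- `(w, η) ↦ ∑_T ∫_T ∇w · η dx`. -/
def gradVec : V 𝓜 p →ₗ[ℝ] VecV 𝓜 p →ₗ[ℝ] ℝ :=
  ∑ i, (eltPairing i).compl₁₂ (grad i) (vloc i)

/-- The stabilization term `(w, v) ↦ ∑_F ∫_F σ ⟦w⟧ · ⟦v⟧ ds`. -/
def stab (α : ℝ) : LinearMap.BilinForm ℝ (V 𝓜 p) :=
  ∑ F, 𝓜.penalty p α F • (facePairing F).compl₁₂ (jump F) (jump F)

/-- The DG bilinear form `𝒜(w, v)`. -/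
def form (M : Method 𝓜) (α : ℝ) : LinearMap.BilinForm ℝ (V 𝓜 p) :=
  gradGrad + gradVec.compl₂ (lift M) + (gradVec.compl₂ (lift M)).flip + stab α +
    M.theta • vecL2.compl₁₂ (lift M) (lift M)

theorem form_apply (M : Method 𝓜) (α : ℝ) (w v : V 𝓜 p) :
    form M α w v = ∑ i, (∫ x in 𝓜.elt i, ⟪∇ (loc i w) x, ∇ (loc i v) x⟫)
      + ∑ i, (∫ x in 𝓜.elt i, ⟪∇ (loc i w) x, vloc i (lift M v) x⟫)
      + ∑ i, (∫ x in 𝓜.elt i, ⟪vloc i (lift M w) x, ∇ (loc i v) x⟫)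
      + ∑ F, 𝓜.penalty p α F * (∫ x, ⟪jump F w x, jump F v x⟫ ∂𝓜.faceMeasure F)
      + M.theta * ∑ i, (∫ x in 𝓜.elt i, ⟪vloc i (lift M w) x, vloc i (lift M v) x⟫) := by
  simp only [real_inner_comm _ (vloc _ (lift M w) _)]
  simp only [real_inner_comm (vloc _ (lift M w) _) (vloc _ (lift M v) _)]
  simp only [form, gradGrad, gradVec, stab, vecL2, LinearMap.add_apply, LinearMap.compl₂_apply,
    LinearMap.flip_apply, LinearMap.smul_apply, LinearMap.sum_apply, LinearMap.compl₁₂_apply,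
    smul_eq_mul]
  rfl

/-! ### The discrete inner product, the operator `A` and its powers, and the smoother -/

variable {n : ℕ} (b : Basis (Fin n) ℝ (𝓜.shape.poly d p))

/-- The basis of `V` obtained by mapping a basis on the reference element to each element; each
basis function is supported in one element. -/
def basis : Basis (Σ _ : Fin 𝓜.card, Fin n) ℝ (V 𝓜 p) := Pi.basis fun _ => b

/-- The mesh-dependent inner product `(u, v) = h^d ∑_j u_j v_j`. -/
def discInner (u v : V 𝓜 p) : ℝ :=
  𝓜.size ^ d * ∑ j, (basis b).repr u j * (basis b).repr v j

/-- The operator `A` with `(A u, v) = 𝒜(u, v)` for all `v` (see `discInner_opA`). -/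
def opA (M : Method 𝓜) (α : ℝ) : V 𝓜 p →ₗ[ℝ] V 𝓜 p :=
  ∑ j, ((𝓜.size ^ d)⁻¹ • (form M α).flip (basis b j)).smulRight (basis b j)

theorem discInner_opA (hd : 0 < d) (M : Method 𝓜) (α : ℝ) (u v : V 𝓜 p) :
    discInner b (opA b M α u) v = form M α u v := by
  have hh : 𝓜.size ^ d ≠ 0 := (pow_pos (𝓜.size_pos hd) d).ne'
  have h1 : ∀ j, (basis b).repr (opA b M α u) j = (𝓜.size ^ d)⁻¹ * form M α u (basis b j) := by
    intro j
    simp [opA, LinearMap.sum_apply, Finsupp.single_apply]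
  simp only [discInner, h1]
  conv_rhs => rw [← (basis b).sum_repr v]
  rw [map_sum, Finset.mul_sum]
  refine Finset.sum_congr rfl fun j _ => ?_
  rw [map_smul, smul_eq_mul]
  field_simp

/-- The real power `A^s` of the operator `A`, which is self-adjoint for the discrete inner
product: its matrix in the basis of `V` (orthogonal, with basis vectors of equal length, for the
discrete inner product) is the power in the sense of the functional calculus for symmetric
matrices, that is, it has the same eigenvectors and the eigenvalues `λ^s`. -/
def opPow (M : Method 𝓜) (α s : ℝ) : V 𝓜 p →ₗ[ℝ] V 𝓜 p :=
  LinearMap.toMatrix (basis b) (basis b) |>.symm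
    (cfc (fun x : ℝ => x ^ s) (LinearMap.toMatrix (basis b) (basis b) (opA b M α)))

/-- The discrete norm `|||v|||_s = √(A^s v, v)`. -/
def discNorm (M : Method 𝓜) (α s : ℝ) (v : V 𝓜 p) : ℝ :=
  √(discInner b (opPow b M α s v) v)

/-- The error propagation operator `G = I - Λ⁻¹ A` of the Richardson smoother. -/
def smoother (M : Method 𝓜) (α Λ : ℝ) : Module.End ℝ (V 𝓜 p) := 1 - Λ⁻¹ • opA b M α

end HpDG

end

/-!
The operator `A` has, in the basis of `V`, a symmetric matrix `H`, because the DG bilinear form is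
symmetric and the basis is orthogonal for the discrete inner product, with vectors of equal length.
Its eigenvalues lie in `[0, Λ]`: the form is positive by assumption if `θ = 0`, and for `θ = 1` it
is the sum of `∑_T ∫_T |∇v + 𝒢(v)|² dx` and the nonnegative stabilization term
(`HpDG.form_self_nonneg`). All operators in the claim are functions of `H`, so the claim reduces to
the scalar inequality

`λ ^ s * (1 - λ / Λ) ^ (2 m) ≤ K ^ 2 * λ ^ t` for `0 ≤ λ ≤ Λ`

on the spectrum (`HpDG.dotProduct_cfc_mulVec_le` is the transfer). With `x = λ / Λ` and `r = s - t`,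
it follows from `x * (1 + m) * (1 - x) ^ m ≤ 1`, which is Bernoulli's inequality: the `r`-th power
of this bound controls `x ^ r * (1 - x) ^ (2 m)` since `r ≤ 2`
(`HpDG.rpow_mul_one_sub_div_pow_le`). The factor `Λ ^ r` is at most `(C_Λ p⁴ / h²) ^ r`, which gives
the constant `C = max 1 C_Λ`.
-/

open MeasureTheory Module
open scoped Gradient RealInnerProductSpace

namespace HpDG

/-! ### The scalar inequality -/

theorem mul_one_sub_pow_le_one {x : ℝ} (hx0 : 0 ≤ x) (hx1 : x ≤ 1) (m : ℕ) :
    x * (1 + m) * (1 - x) ^ m ≤ 1 := by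
  have hB : 1 + (m : ℝ) * x ≤ (1 + x) ^ m := one_add_mul_le_pow (by linarith) m
  have h0 : 0 ≤ (1 - x) ^ m := pow_nonneg (by linarith) m
  calc x * (1 + m) * (1 - x) ^ m ≤ (1 + x) ^ m * (1 - x) ^ m := by gcongr; linarith
    _ = (1 - x ^ 2) ^ m := by rw [← mul_pow]; ring
    _ ≤ 1 := pow_le_one₀ (by nlinarith) (by nlinarith)

theorem rpow_mul_one_sub_pow_le {x r : ℝ} (hx0 : 0 ≤ x) (hx1 : x ≤ 1) (hr0 : 0 ≤ r) (hr2 : r ≤ 2)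
    (m : ℕ) : x ^ r * ((1 - x) ^ m) ^ 2 ≤ (1 + (m : ℝ)) ^ (-r) := by
  have hy : 0 ≤ (1 - x) ^ m := pow_nonneg (by linarith) m
  have hy1 : (1 - x) ^ m ≤ 1 := pow_le_one₀ (by linarith) (by linarith)
  have hm : (0 : ℝ) < 1 + m := by positivity
  -- `y ^ 2 ≤ y ^ r` for `y = (1 - x) ^ m ≤ 1`; the cases `y = 0`, `r = 0` are covered as well.
  have h2 : ((1 - x) ^ m) ^ 2 ≤ ((1 - x) ^ m) ^ r := by
    rw [← Real.rpow_two]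
    exact Real.rpow_le_rpow_of_exponent_ge_of_imp hy hy1 hr2 fun _ h => by norm_num at h
  have h1 : (x * (1 + m) * (1 - x) ^ m) ^ r ≤ 1 :=
    Real.rpow_le_one (by positivity) (mul_one_sub_pow_le_one hx0 hx1 m) hr0
  rw [Real.mul_rpow (by positivity) hy, Real.mul_rpow hx0 hm.le] at h1
  rw [Real.rpow_neg hm.le, ← one_div, le_div_iff₀ (by positivity)]
  calc x ^ r * ((1 - x) ^ m) ^ 2 * (1 + (m : ℝ)) ^ r
      ≤ x ^ r * ((1 - x) ^ m) ^ r * (1 + (m : ℝ)) ^ r := by gcongr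
    _ = x ^ r * (1 + (m : ℝ)) ^ r * ((1 - x) ^ m) ^ r := by ring
    _ ≤ 1 := h1

/-- The smoothing estimate for a single eigenvalue `μ`. For `μ = 0` it rests on `0 ^ s = 0` for
`s > 0`, so that no positive lower bound of the spectrum is needed. -/
theorem rpow_mul_one_sub_div_pow_le {μ Λ s t : ℝ} (hμ : 0 ≤ μ) (hμΛ : μ ≤ Λ) (ht : 0 ≤ t)
    (hts : t ≤ s) (hs : s ≤ 2) (m : ℕ) :
    μ ^ s * ((1 - Λ⁻¹ * μ) ^ m) ^ 2 ≤ Λ ^ (s - t) * (1 + (m : ℝ)) ^ (t - s) * μ ^ t := by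
  have hm : (0 : ℝ) < 1 + m := by positivity
  rcases hμ.eq_or_lt with rfl | hμ
  · rcases hts.eq_or_lt with rfl | hlt
    · simp
    · rw [Real.zero_rpow (by linarith), zero_mul]
      positivity
  have hΛ : 0 < Λ := hμ.trans_le hμΛ
  have hx0 : 0 ≤ Λ⁻¹ * μ := by positivity
  have hx1 : Λ⁻¹ * μ ≤ 1 := by rw [inv_mul_le_iff₀ hΛ]; linarith
  have key := rpow_mul_one_sub_pow_le hx0 hx1 (r := s - t) (by linarith) (by linarith) m
  rw [neg_sub] at key
  have hsplit : μ ^ s = Λ ^ (s - t) * (Λ⁻¹ * μ) ^ (s - t) * μ ^ t := by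
    rw [← Real.mul_rpow hΛ.le hx0, mul_inv_cancel_left₀ hΛ.ne', ← Real.rpow_add hμ]
    ring_nf
  calc μ ^ s * ((1 - Λ⁻¹ * μ) ^ m) ^ 2
      = Λ ^ (s - t) * ((Λ⁻¹ * μ) ^ (s - t) * ((1 - Λ⁻¹ * μ) ^ m) ^ 2) * μ ^ t := by
        rw [hsplit]; ring
    _ ≤ _ := by gcongr

/-- `K ^ 2` for the constant `K` of the smoothing property dominates the scalar bound. -/
theorem rpow_le_smoothing_constant_sq {CΛ P h Λ s t : ℝ} (hP : 0 < P) (hh : 0 < h) (hΛ : 0 ≤ Λ)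
    (hΛC : Λ ≤ CΛ * (P ^ 4 / h ^ 2)) (hts : t ≤ s) (hst : s - t ≤ 2) {a : ℝ} (ha : 0 < a) :
    Λ ^ (s - t) * a ^ (t - s) ≤
      (max 1 CΛ * P ^ (2 * (s - t)) * h ^ (t - s) * a ^ ((t - s) / 2)) ^ 2 := by
  have hr : 0 ≤ s - t := by linarith
  have hC : (1 : ℝ) ≤ max 1 CΛ := le_max_left _ _
  have h1 : Λ ≤ max 1 CΛ * (P ^ 4 / h ^ 2) :=
    hΛC.trans (mul_le_mul_of_nonneg_right (le_max_right _ _) (by positivity))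
  have h2 : Λ ^ (s - t) ≤ (max 1 CΛ) ^ 2 * (P ^ 4 / h ^ 2) ^ (s - t) := by
    refine (Real.rpow_le_rpow hΛ h1 hr).trans ?_
    rw [Real.mul_rpow (by positivity) (by positivity), ← Real.rpow_two (max 1 CΛ)]
    exact mul_le_mul_of_nonneg_right (Real.rpow_le_rpow_of_exponent_le hC hst) (by positivity)
  have h3 : (P ^ 4 / h ^ 2) ^ (s - t) = (P ^ (2 * (s - t)) * h ^ (t - s)) ^ 2 := by
    rw [show P ^ 4 / h ^ 2 = (P ^ (2 : ℝ) * h⁻¹) ^ 2 by rw [Real.rpow_two]; field_simp,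
      ← Real.rpow_pow_comm (by positivity), Real.mul_rpow (by positivity) (by positivity),
      ← Real.rpow_mul hP.le, Real.inv_rpow hh.le, ← Real.rpow_neg hh.le, neg_sub]
  have h4 : a ^ (t - s) = (a ^ ((t - s) / 2)) ^ 2 := by
    rw [← Real.rpow_mul_natCast ha.le]
    norm_num
  rw [h4]
  calc Λ ^ (s - t) * (a ^ ((t - s) / 2)) ^ 2
      ≤ (max 1 CΛ) ^ 2 * (P ^ 4 / h ^ 2) ^ (s - t) * (a ^ ((t - s) / 2)) ^ 2 := by gcongr
    _ = _ := by rw [h3]; ring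

/-! ### Functional calculus for symmetric matrices -/

open scoped MatrixOrder in
/-- A pointwise inequality `g ^ 2 * f₁ ≤ k * f₂` on the spectrum of `H` turns into an inequality
between the quadratic forms of `f₁(H)` at `g(H) x` and of `f₂(H)` at `x`. -/
theorem dotProduct_cfc_mulVec_le {ι : Type*} [Fintype ι] [DecidableEq ι] {H : Matrix ι ι ℝ}
    (_hH : IsSelfAdjoint H) {f₁ f₂ g : ℝ → ℝ} {k : ℝ}
    (h : ∀ μ ∈ spectrum ℝ H, f₁ μ * g μ ^ 2 ≤ k * f₂ μ) (x : ι → ℝ) :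
    (cfc f₁ H).mulVec ((cfc g H).mulVec x) ⬝ᵥ (cfc g H).mulVec x ≤
      k * ((cfc f₂ H).mulVec x ⬝ᵥ x) := by
  have hc : ∀ f : ℝ → ℝ, ContinuousOn f (spectrum ℝ H) := fun f =>
    (Matrix.finite_real_spectrum (A := H)).continuousOn f
  have hg : (cfc g H).transpose = cfc g H := (IsSelfAdjoint.cfc (f := g) (a := H)).star_eq
  have hprod : cfc (fun μ => f₁ μ * g μ ^ 2) H = cfc g H * (cfc f₁ H * cfc g H) := by
    rw [← cfc_mul _ _ H (hc _) (hc _), ← cfc_mul _ _ H (hc _) (hc _)]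
    exact cfc_congr fun μ _ => by ring
  have hle : cfc (fun μ => f₁ μ * g μ ^ 2) H ≤ k • cfc f₂ H := by
    rw [← cfc_smul k f₂ H (hc _)]
    exact cfc_mono h (hc _) (hc _)
  have hps := (Matrix.le_iff.1 hle).dotProduct_mulVec_nonneg x
  rw [hprod, Matrix.sub_mulVec, dotProduct_sub, sub_nonneg, Matrix.smul_mulVec, dotProduct_smul,
    smul_eq_mul, star_trivial] at hps
  calc _ = x ⬝ᵥ (cfc g H * (cfc f₁ H * cfc g H)).mulVec x := by
        rw [← Matrix.mulVec_mulVec, ← Matrix.mulVec_mulVec, Matrix.dotProduct_mulVec x,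
          ← Matrix.mulVec_transpose, hg, dotProduct_comm]
    _ ≤ _ := hps
    _ = _ := by rw [dotProduct_comm x]

theorem cfc_one_sub_mul_pow {ι : Type*} [Fintype ι] [DecidableEq ι] {H : Matrix ι ι ℝ}
    (hH : IsSelfAdjoint H) (c : ℝ) (m : ℕ) :
    cfc (fun μ : ℝ => (1 - c * μ) ^ m) H = (1 - c • H) ^ m := by
  rw [cfc_pow (fun μ : ℝ => 1 - c * μ) m H, cfc_sub (fun _ : ℝ => 1) (fun μ => c * μ) H,
    cfc_const_one ℝ H, cfc_const_mul_id c H]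

/-! ### Symmetry and positivity of the DG form -/

variable {d : ℕ} {𝓜 : Mesh d} {p : ℕ}

theorem form_comm (M : Method 𝓜) (α : ℝ) (w v : V 𝓜 p) : form M α w v = form M α v w := by
  rw [form_apply, form_apply]
  simp only [real_inner_comm (vloc _ (lift M w) _), real_inner_comm (jump _ w _),
    real_inner_comm (∇ (loc _ w) _)]
  ring

theorem penalty_nonneg {α : ℝ} (hα : 0 ≤ α) (F : 𝓜.Face) : 0 ≤ 𝓜.penalty p α F := by
  have h : ∀ i, 0 ≤ 𝓜.eltSize i := fun i => Metric.diam_nonneg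
  rcases F with F | F
  · exact div_nonneg (by positivity) (le_min (h _) (h _))
  · exact div_nonneg (by positivity) (h _)

theorem pairing_self_nonneg {G : Type*} [NormedAddCommGroup G] [InnerProductSpace ℝ G]
    (μ : Measure (E d)) (hμ : ∀ f : C(E d, ℝ), Integrable f μ) (f : C(E d, G)) :
    0 ≤ pairing μ hμ f f :=
  integral_nonneg fun _ => real_inner_self_nonneg

theorem stab_self_nonneg {α : ℝ} (hα : 0 ≤ α) (v : V 𝓜 p) : 0 ≤ stab α v v := by
  simp only [stab, LinearMap.sum_apply, LinearMap.smul_apply, LinearMap.compl₁₂_apply, smul_eq_mul]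
  exact Finset.sum_nonneg fun F _ => mul_nonneg (penalty_nonneg hα F) (pairing_self_nonneg _ _ _)

/-- For `θ = 1` the volume terms of the form are the square `∑_T ∫_T |∇v + 𝒢(v)|² dx`. -/
theorem form_self_of_theta_eq_one {M : Method 𝓜} (hM : M.theta = 1) (α : ℝ) (v : V 𝓜 p) :
    form M α v v = ∑ i, eltPairing i (grad i v + vloc i (lift M v)) (grad i v + vloc i (lift M v))
      + stab α v v := by
  have hc : ∀ i, eltPairing i (vloc i (lift M v)) (grad i v) =
      eltPairing i (grad i v) (vloc i (lift M v)) := fun i =>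
    integral_congr_ae (Filter.Eventually.of_forall fun x => real_inner_comm _ _)
  simp only [form, gradGrad, gradVec, vecL2, hM, LinearMap.add_apply, LinearMap.compl₂_apply,
    LinearMap.flip_apply, one_smul, LinearMap.sum_apply, LinearMap.compl₁₂_apply,
    map_add, hc, Finset.sum_add_distrib]
  ring

theorem form_self_nonneg {M : Method 𝓜} {α : ℝ} (hα : 0 ≤ α)
    (hcoer : M.theta = 0 → ∀ v : V 𝓜 p, v ≠ 0 → 0 < form M α v v) (v : V 𝓜 p) :
    0 ≤ form M α v v := by
  have h01 : M.theta = 0 ∨ M.theta = 1 := by cases M <;> simp [Method.theta]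
  rcases h01 with h | h
  · rcases eq_or_ne v 0 with rfl | hv
    · simp
    · exact (hcoer h v hv).le
  · rw [form_self_of_theta_eq_one h]
    exact add_nonneg (Finset.sum_nonneg fun i _ => pairing_self_nonneg _ _ _)
      (stab_self_nonneg hα v)

/-! ### The matrix of the operator -/

variable {n : ℕ} (b : Basis (Fin n) ℝ (𝓜.shape.poly d p))

/-- The matrix of the operator `A` in the basis of `V`. -/
noncomputable def matA (M : Method 𝓜) (α : ℝ) :
    Matrix (Σ _ : Fin 𝓜.card, Fin n) (Σ _ : Fin 𝓜.card, Fin n) ℝ :=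
  LinearMap.toMatrix (basis b) (basis b) (opA b M α)

theorem isSelfAdjoint_matA (M : Method 𝓜) (α : ℝ) : IsSelfAdjoint (matA b M α) := by
  have h : ∀ i j, matA b M α i j = (𝓜.size ^ d)⁻¹ * form M α (basis b j) (basis b i) := by
    intro i j
    simp [matA, LinearMap.toMatrix_apply, opA, LinearMap.sum_apply, Finsupp.single_apply]
  ext i j
  rw [Matrix.star_apply, star_trivial, h, h, form_comm]

theorem hasEigenvalue_opA_of_mem_spectrum {M : Method 𝓜} {α μ : ℝ}
    (hμ : μ ∈ spectrum ℝ (matA b M α)) : Module.End.HasEigenvalue (opA b M α) μ := by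
  rw [Module.End.hasEigenvalue_iff_mem_spectrum]
  have := AlgEquiv.spectrum_eq (LinearMap.toMatrixAlgEquiv (basis b)) (opA b M α)
  rw [← this]
  exact hμ

theorem discInner_eq_dotProduct (u v : V 𝓜 p) :
    discInner b u v = 𝓜.size ^ d * (⇑((basis b).repr u) ⬝ᵥ ⇑((basis b).repr v)) := rfl

theorem discInner_self_pos (hd : 0 < d) {v : V 𝓜 p} (hv : v ≠ 0) : 0 < discInner b v v := by
  rw [discInner_eq_dotProduct]
  refine mul_pos (pow_pos (𝓜.size_pos hd) d) ?_
  refine lt_of_le_of_ne (Finset.sum_nonneg fun i _ => mul_self_nonneg _) fun h => hv ?_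
  have h0 := dotProduct_self_eq_zero.1 h.symm
  exact (basis b).repr.map_eq_zero_iff.1 (DFunLike.coe_injective h0)

theorem eigenvalue_opA_nonneg (hd : 0 < d) {M : Method 𝓜} {α : ℝ}
    (hpos : ∀ v : V 𝓜 p, 0 ≤ form M α v v) {μ : ℝ}
    (hμ : Module.End.HasEigenvalue (opA b M α) μ) : 0 ≤ μ := by
  obtain ⟨v, hv⟩ := hμ.exists_hasEigenvector
  have h := discInner_opA b hd M α v v
  rw [hv.apply_eq_smul] at h
  have h' : discInner b (μ • v) v = μ * discInner b v v := by
    rw [discInner_eq_dotProduct, discInner_eq_dotProduct, map_smul, Finsupp.coe_smul,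
      smul_dotProduct, smul_eq_mul]
    ring
  have h0 := hpos v
  rw [← h, h'] at h0
  exact nonneg_of_mul_nonneg_left h0 (discInner_self_pos b hd hv.2)

theorem repr_opPow (M : Method 𝓜) (α s : ℝ) (v : V 𝓜 p) :
    ⇑((basis b).repr (opPow b M α s v)) =
      (cfc (fun x : ℝ => x ^ s) (matA b M α)).mulVec ((basis b).repr v) := by
  rw [← LinearMap.toMatrix_mulVec_repr (basis b) (basis b) (opPow b M α s) v, opPow,
    LinearEquiv.apply_symm_apply, matA]

theorem repr_smoother_pow (M : Method 𝓜) (α Λ : ℝ) (m : ℕ) (v : V 𝓜 p) :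
    ⇑((basis b).repr ((smoother b M α Λ ^ m) v)) =
      (cfc (fun μ : ℝ => (1 - Λ⁻¹ * μ) ^ m) (matA b M α)).mulVec ((basis b).repr v) := by
  have hG : LinearMap.toMatrix (basis b) (basis b) (smoother b M α Λ) = 1 - Λ⁻¹ • matA b M α := by
    refine (map_sub (LinearMap.toMatrix (basis b) (basis b)) 1 (Λ⁻¹ • opA b M α)).trans ?_
    rw [map_smul, LinearMap.toMatrix_one, matA]
  rw [cfc_one_sub_mul_pow (isSelfAdjoint_matA b M α),
    ← LinearMap.toMatrix_mulVec_repr (basis b) (basis b) _ v, ← LinearMap.toMatrix_pow, hG]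

/-- The norm estimate that follows from a scalar inequality on the spectrum. -/
theorem discNorm_smoother_pow_le {M : Method 𝓜} {α Λ s t K : ℝ} {m : ℕ} (hK : 0 ≤ K)
    (h : ∀ μ, Module.End.HasEigenvalue (opA b M α) μ →
      μ ^ s * ((1 - Λ⁻¹ * μ) ^ m) ^ 2 ≤ K ^ 2 * μ ^ t) (v : V 𝓜 p) :
    discNorm b M α s ((smoother b M α Λ ^ m) v) ≤ K * discNorm b M α t v := by
  have hsize : 0 ≤ 𝓜.size := Real.iSup_nonneg fun i => Metric.diam_nonneg
  rw [discNorm, discNorm, ← Real.sqrt_sq hK, ← Real.sqrt_mul (sq_nonneg K)]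
  refine Real.sqrt_le_sqrt ?_
  rw [discInner_eq_dotProduct, discInner_eq_dotProduct, repr_opPow, repr_opPow, repr_smoother_pow,
    mul_left_comm]
  exact mul_le_mul_of_nonneg_left (dotProduct_cfc_mulVec_le (isSelfAdjoint_matA b M α)
    (fun μ hμ => h μ (hasEigenvalue_opA_of_mem_spectrum b hμ)) _) (pow_nonneg hsize d)

end HpDG

theorem lemma4p1 (CΛ : ℝ) (hCΛ : 0 < CΛ) :
    ∃ C : ℝ, 0 < C ∧
      ∀ (d : ℕ) (_ : d = 2 ∨ d = 3) (𝓜 : HpDG.Mesh d) (p : ℕ) (_ : 1 ≤ p)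
        (n : ℕ) (b : Module.Basis (Fin n) ℝ (𝓜.shape.poly d p))
        (_ : HpDG.RefShape.IsOrthonormalBasis d b)
        (M : HpDG.Method 𝓜) (α : ℝ) (_ : 0 < α)
        -- for SIPG and SIPG(δ), the penalty parameter is large enough for coercivity
        (_ : M.theta = 0 → ∀ v : HpDG.V 𝓜 p, v ≠ 0 → 0 < HpDG.form M α v v)
        (Λ : ℝ)
        (_ : ∀ μ : ℝ, Module.End.HasEigenvalue (HpDG.opA b M α) μ → |μ| ≤ Λ)
        (_ : Λ ≤ CΛ * ((p : ℝ) ^ 4 / 𝓜.size ^ 2))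
        (s t : ℝ) (_ : 0 ≤ t) (_ : t ≤ s) (_ : s ≤ 2) (m : ℕ) (v : HpDG.V 𝓜 p),
        HpDG.discNorm b M α s ((HpDG.smoother b M α Λ ^ m) v) ≤
          C * (p : ℝ) ^ (2 * (s - t)) * 𝓜.size ^ (t - s) * (1 + (m : ℝ)) ^ ((t - s) / 2) *
            HpDG.discNorm b M α t v := by
  refine ⟨max 1 CΛ, by positivity, ?_⟩
  intro d hd 𝓜 p hp n b _ M α hα hcoer Λ hspec hΛ s t ht hts hs m v
  have hd0 : 0 < d := by omega
  have hh : 0 < 𝓜.size := 𝓜.size_pos hd0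
  have hP : (0 : ℝ) < p := by exact_mod_cast hp
  refine HpDG.discNorm_smoother_pow_le b (by positivity) (fun μ hμ => ?_) v
  have hμ0 : 0 ≤ μ :=
    HpDG.eigenvalue_opA_nonneg b hd0 (HpDG.form_self_nonneg hα.le hcoer) hμ
  have hμΛ : μ ≤ Λ := (le_abs_self μ).trans (hspec μ hμ)
  refine (HpDG.rpow_mul_one_sub_div_pow_le hμ0 hμΛ ht hts hs m).trans ?_
  exact mul_le_mul_of_nonneg_right (HpDG.rpow_le_smoothing_constant_sq hP hh (hμ0.trans hμΛ) hΛ hts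
    (by linarith) (by positivity)) (Real.rpow_nonneg hμ0 t)
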